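/- An MV-algebra is $(A,\oplus,\neg,0)$ with the usual axioms; $1=\neg 0$, $x\ominus y=\neg(\neg x\oplus y)$, $d(x,y)=(x\ominus y)\oplus(y\ominus x)$, $x\le y$ iff $x\oplus z=y$ for some $z$. An ideal is a subset containing $0$, downward closed and closed under $\oplus$; an ideal $P$ is prime if $1\notin P$ and for all $x,y$ one has $x\ominus y\in P$ or $y\ominus x\in P$; a maximal ideal is a maximal proper ideal (it is automatically prime). $A$ is hyperarchimedean if for every $a\in A$ there is an integer $n\ge 1$ with $na=(n+1)a$, where $na=a\oplus\cdots\oplus a$ ($n$ times). $A$ is semisimple if $1\ne 0$ and the intersection of all maximal ideals is $\{0\}$. Let $Z_A$ be the set of prime ideals of $A$ with the topology having as base the sets $W_a=\{P : a\in P\}$, $a\in A$, and let $M_A\subseteq Z_A$ be the subspace of maximal ideals. For an ideal $P$ let $A/P$ be the quotient of $A$ by $x\sim y\iff d(x,y)\in P$, and let $\mathsf{Spec}_A=(\pi:E_A\to Z_A)$, where $E_A=\{([a]_P,P) : a\in A,\ P\in Z_A\}$ is the disjoint union of the quotients $A/P$, $\pi([a]_P,P)=P$, and $E_A$ has as base of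 its topology the sets $\widehat a(W_b)$, $a,b\in A$, with $\widehat a(P)=([a]_P,P)$. A Hausdorff sheaf is a local homeomorphism with Hausdorff total space. Let $X_A\subseteq[0,1]^A$ be the subspace of MV-algebra morphisms $\chi:A\to[0,1]$, where $[0,1]$ has the operations $x\oplus y=\min(1,x+y)$, $\neg x=1-x$ and the usual topology; put $W^X_a=\{\chi\in X_A : \chi(a)=0\}$ and $\kappa(\chi)=\ker\chi=\{a : \chi(a)=0\}$, which is a maximal ideal. Theorem. (a) For an arbitrary MV-algebra $A$ the following are equivalent: (1) $A$ is hyperarchimedean; (2) every prime ideal of $A$ is maximal, i.e. $Z_A=M_A$; (3) $Z_A$ is Hausdorff; (4) $\mathsf{Spec}_A=(E_A\to Z_A)$ is a Hausdorff sheaf; (5) for every $a\in A$ the set $W_a$ is closed (thus clopen) in $Z_A$; (6) $\kappa:X_A\to Z_A$ is a homeomorphism (in which case $\kappa:X_A\to M_A$ is also a homeomorphism); (7) $Z_A$ is a Stone space (compact Hausdorff with an open base of clopen sets). (b) For a semisimple MV-algebra $A$ the following are equivalent: (1) $A$ is hyperarchimedean; (2) for every $a\in A$ the set $W^X_a$ is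 open (thus clopen) in $X_A$; (3) $\kappa:X_A\to Z_A$ is continuous; (4) $M_A$ is compact; (5) $\kappa:X_A\to M_A$ is a homeomorphism. -/

import Mathlib

/-- An MV-algebra `(A, ⊕, ¬, 0)`. -/
class MVAlgebra (A : Type*) extends Zero A where
  oplus : A → A → A
  neg : A → A
  oplus_assoc : ∀ x y z : A, oplus (oplus x y) z = oplus x (oplus y z)
  oplus_comm : ∀ x y : A, oplus x y = oplus y x
  oplus_zero : ∀ x : A, oplus x 0 = x
  neg_neg_eq : ∀ x : A, neg (neg x) = x
  oplus_neg_zero : ∀ x : A, oplus x (neg 0) = neg 0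
  lukasiewicz : ∀ x y : A,
    oplus (neg (oplus (neg x) y)) y = oplus (neg (oplus (neg y) x)) x

namespace MVAlgebra

variable {A : Type*} [MVAlgebra A]

/-- The top element `1 = ¬0`. -/
def top (A : Type*) [MVAlgebra A] : A := neg 0

/-- `x ⊖ y = x ⊙ ¬y = ¬(¬x ⊕ ¬¬y)`. -/
def ominus (x y : A) : A := neg (oplus (neg x) (neg (neg y)))

/-- The order `x ≤ y ↔ ∃ z, x ⊕ z = y`. -/
def Le (x y : A) : Prop := ∃ z : A, oplus x z = y

/-- The distance `d(x, y) = (x ⊖ y) ⊕ (y ⊖ x)`. -/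
def distance (x y : A) : A := oplus (ominus x y) (ominus y x)

/-- The multiple `n x = x ⊕ ⋯ ⊕ x` (`n` times), with `0 x = 0`. -/
def nmul : ℕ → A → A
  | 0, _ => 0
  | n + 1, x => oplus (nmul n x) x

/-- `a` is archimedean if `n a = (n + 1) a` for some integer `n ≥ 1`. -/
def IsArchimedean (a : A) : Prop := ∃ n : ℕ, 1 ≤ n ∧ nmul n a = nmul (n + 1) a

/-- Every element of `A` is archimedean. -/
def IsHyperarchimedean (A : Type*) [MVAlgebra A] : Prop := ∀ a : A, IsArchimedean a

theorem neg_oplus_self (x : A) : oplus (neg x) x = neg 0 := by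
  have h := lukasiewicz x (neg 0)
  rw [oplus_neg_zero (neg x), oplus_neg_zero, neg_neg_eq, oplus_comm 0 x, oplus_zero] at h
  exact h.symm

theorem eq_zero_of_oplus {x y : A} (h : oplus x y = 0) : x = 0 := by
  have h1 : oplus (neg x) (oplus x y) = neg 0 := by
    rw [← oplus_assoc, neg_oplus_self, oplus_comm, oplus_neg_zero]
  rw [h, oplus_zero] at h1
  rw [← neg_neg_eq x, h1, neg_neg_eq]

theorem ominus_self (x : A) : ominus x x = 0 := by
  rw [ominus, neg_neg_eq, neg_oplus_self, neg_neg_eq]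

theorem distance_self (x : A) : distance x x = 0 := by
  rw [distance, ominus_self, oplus_zero]

theorem distance_comm (x y : A) : distance x y = distance y x := oplus_comm _ _

/-- `x ⊖ z ≤ w` as soon as `w ⊕ z` is above `x`. -/
theorem ominus_le {x z w u : A} (h : oplus x u = oplus w z) : Le (ominus x z) w := by
  -- `¬(x ⊖ z) ⊕ w = ¬x ⊕ z ⊕ w = 1`
  have h1 : oplus (neg (ominus x z)) w = neg 0 := by
    rw [ominus, neg_neg_eq, neg_neg_eq, oplus_assoc, oplus_comm z w, ← h, ← oplus_assoc,
      neg_oplus_self, oplus_comm, oplus_neg_zero]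
  refine ⟨neg (oplus (neg w) (ominus x z)), ?_⟩
  rw [oplus_comm, lukasiewicz, h1, neg_neg_eq, oplus_comm, oplus_zero]

/-- The triangle inequality for `⊖`. -/
theorem ominus_triangle (x y z : A) :
    Le (ominus x z) (oplus (ominus x y) (ominus y z)) := by
  have h1 : oplus (ominus y z) z = oplus (neg (oplus (neg z) y)) y := by
    rw [ominus, neg_neg_eq, lukasiewicz]
  have h2 : oplus (ominus x y) y = oplus (neg (oplus (neg y) x)) x := by
    rw [ominus, neg_neg_eq, lukasiewicz]
  apply ominus_le (u := oplus (neg (oplus (neg z) y)) (neg (oplus (neg y) x)))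
  rw [oplus_assoc, h1, oplus_comm (neg (oplus (neg z) y)) y, ← oplus_assoc (ominus x y), h2,
    oplus_comm (neg (oplus (neg y) x)) x, oplus_assoc,
    oplus_comm (neg (oplus (neg y) x))]

end MVAlgebra

open MVAlgebra in
/-- Ideals of an MV-algebra. -/
@[ext]
structure MVIdeal (A : Type*) [MVAlgebra A] where
  carrier : Set A
  zero_mem : (0 : A) ∈ carrier
  down_closed : ∀ x y : A, x ∈ carrier → Le y x → y ∈ carrier
  oplus_mem : ∀ x y : A, x ∈ carrier → y ∈ carrier → oplus x y ∈ carrier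

namespace MVIdeal

open MVAlgebra

variable {A : Type*} [MVAlgebra A]

/-- Prime ideals: `1 ∉ P`, and `x ⊖ y ∈ P` or `y ⊖ x ∈ P` for all `x, y`. -/
def IsPrime (P : MVIdeal A) : Prop :=
  top A ∉ P.carrier ∧ ∀ x y : A, ominus x y ∈ P.carrier ∨ ominus y x ∈ P.carrier

/-- Maximal ideals: the maximal elements among the proper ideals. -/
def IsMaximal (M : MVIdeal A) : Prop :=
  top A ∉ M.carrier ∧
    ∀ J : MVIdeal A, M.carrier ⊆ J.carrier → top A ∉ J.carrier → J = M

/-- The congruence `x ∼ y ↔ d(x, y) ∈ I`, whose quotient is `A/I`. -/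
def setoid (I : MVIdeal A) : Setoid A where
  r x y := distance x y ∈ I.carrier
  iseqv := by
    refine ⟨fun x => ?_, fun {x y} h => ?_, fun {x y z} h1 h2 => ?_⟩
    · rw [distance_self]; exact I.zero_mem
    · rw [distance_comm]; exact h
    · have l : ∀ {u v : A}, oplus u v ∈ I.carrier → u ∈ I.carrier := fun {u v} h =>
        I.down_closed _ _ h ⟨v, rfl⟩
      have r : ∀ {u v : A}, oplus u v ∈ I.carrier → v ∈ I.carrier := fun {u v} h =>
        l (oplus_comm u v ▸ h)
      exact I.oplus_mem _ _
        (I.down_closed _ _ (I.oplus_mem _ _ (l h1) (l h2)) (ominus_triangle x y z))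
        (I.down_closed _ _ (I.oplus_mem _ _ (r h2) (r h1)) (ominus_triangle z y x))

end MVIdeal

/-- `A` is semisimple if it is nontrivial and its maximal ideals intersect in `{0}`. -/
def MVAlgebra.IsSemisimple (A : Type*) [MVAlgebra A] : Prop :=
  MVAlgebra.top A ≠ 0 ∧ ∀ a : A, (∀ M : MVIdeal A, M.IsMaximal → a ∈ M.carrier) → a = 0

/-- Morphisms of MV-algebras. -/
@[ext]
structure MVHom (A B : Type*) [MVAlgebra A] [MVAlgebra B] where
  toFun : A → B
  map_zero : toFun 0 = 0
  map_oplus : ∀ x y : A, toFun (MVAlgebra.oplus x y) = MVAlgebra.oplus (toFun x) (toFun y)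
  map_neg : ∀ x : A, toFun (MVAlgebra.neg x) = MVAlgebra.neg (toFun x)

namespace MVHom

open MVAlgebra

variable {A B : Type*} [MVAlgebra A] [MVAlgebra B]

/-- The kernel of a morphism. -/
def ker (f : MVHom A B) : MVIdeal A where
  carrier := {x | f.toFun x = 0}
  zero_mem := f.map_zero
  down_closed := by
    rintro x y hx ⟨z, rfl⟩
    have h : oplus (f.toFun y) (f.toFun z) = 0 := by rw [← f.map_oplus]; exact hx
    exact eq_zero_of_oplus h
  oplus_mem := by
    intro x y hx hy
    simp only [Set.mem_ofPred_eq] at hx hy ⊢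
    rw [f.map_oplus, hx, hy, oplus_zero]

end MVHom

/-- The real unit interval, with `x ⊕ y = min(1, x + y)` and `¬x = 1 - x`. -/
noncomputable instance : MVAlgebra unitInterval where
  oplus x y := ⟨min 1 ((x : ℝ) + y),
    le_min zero_le_one (add_nonneg x.2.1 y.2.1), min_le_left _ _⟩
  neg x := ⟨1 - (x : ℝ), sub_nonneg.2 x.2.2, sub_le_self _ x.2.1⟩
  oplus_assoc := by
    rintro ⟨x, hx0, hx1⟩ ⟨y, hy0, hy1⟩ ⟨z, hz0, hz1⟩
    apply Subtype.ext
    simp only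
    rcases min_cases 1 (x + y) with h | h <;> rcases min_cases 1 (y + z) with h' | h' <;>
      rw [h.1, h'.1] <;> first
        | (rw [min_eq_left (by linarith), min_eq_left (by linarith)])
        | rw [add_assoc]
  oplus_comm x y := Subtype.ext (by simp only [add_comm])
  oplus_zero := by
    rintro ⟨x, hx0, hx1⟩
    apply Subtype.ext
    simp [hx1]
  neg_neg_eq x := Subtype.ext (by simp)
  oplus_neg_zero := by
    rintro ⟨x, hx0, hx1⟩
    apply Subtype.ext
    simp [hx0]
  lukasiewicz := by
    rintro ⟨x, hx0, hx1⟩ ⟨y, hy0, hy1⟩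
    apply Subtype.ext
    simp only
    rcases min_cases 1 (1 - x + y) with h | h <;> rcases min_cases 1 (1 - y + x) with h' | h' <;>
      rw [h.1, h'.1] <;> rw [min_eq_right (by linarith), min_eq_right (by linarith)] <;> linarith

/-! The prime spectrum and the maximal spectrum -/

/-- The set `Z_A` of prime ideals of `A`. -/
@[ext]
structure MVSpec (A : Type*) [MVAlgebra A] where
  ideal : MVIdeal A
  isPrime : ideal.IsPrime

namespace MVSpec

variable {A : Type*} [MVAlgebra A]

/-- `W_a = {P | a ∈ P}`. -/
def W (a : A) : Set (MVSpec A) := {P | a ∈ P.ideal.carrier}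

/-- The coZariski topology on `Z_A`, with base the sets `W_a`. -/
instance : TopologicalSpace (MVSpec A) :=
  TopologicalSpace.generateFrom (Set.range (W (A := A)))

end MVSpec

/-- The maximal spectrum `M_A`: the subspace of `Z_A` of the maximal ideals. -/
abbrev MVMaxSpec (A : Type*) [MVAlgebra A] : Type _ :=
  {P : MVSpec A // P.ideal.IsMaximal}

/-- The set `E_A`, the disjoint union of the quotients `A/P`, `P ∈ Z_A`. -/
structure MVEtale (A : Type*) [MVAlgebra A] where
  base : MVSpec A
  fiber : Quotient base.ideal.setoid

namespace MVEtale

variable {A : Type*} [MVAlgebra A]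

/-- The section `â(P) = ([a]_P, P)`. -/
def hat (a : A) (P : MVSpec A) : MVEtale A := ⟨P, Quotient.mk P.ideal.setoid a⟩

/-- The topology on `E_A`, with base the sets `â(W_b)`. -/
instance : TopologicalSpace (MVEtale A) :=
  TopologicalSpace.generateFrom {s | ∃ a b : A, s = hat a '' MVSpec.W b}

end MVEtale

/-- The étale space given by `π : E → X` is a Hausdorff sheaf: `π` is a local homeomorphism
and `E` is Hausdorff. -/
def IsHausdorffSheaf {E X : Type*} [TopologicalSpace E] [TopologicalSpace X]
    (π : E → X) : Prop :=
  IsLocalHomeomorph π ∧ T2Space E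

/-! The spectrum of morphisms into `[0, 1]` -/

/-- `X_A`, the set of morphisms `A → [0, 1]`. -/
abbrev MVX (A : Type*) [MVAlgebra A] : Type _ := MVHom A unitInterval

namespace MVX

open MVAlgebra

variable {A : Type*} [MVAlgebra A]

/-- The topology of `X_A` as a subspace of the product space `[0, 1]^A`. -/
instance : TopologicalSpace (MVX A) :=
  TopologicalSpace.induced (fun χ : MVX A => χ.toFun) inferInstance

/-- `W^X_a = {χ | χ(a) = 0}`. -/
def W (a : A) : Set (MVX A) := {χ | χ.toFun a = 0}

theorem coe_oplus (x y : unitInterval) : ((oplus x y : unitInterval) : ℝ) = min 1 ((x : ℝ) + y) :=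
  rfl

theorem coe_neg (x : unitInterval) : ((neg x : unitInterval) : ℝ) = 1 - x := rfl

theorem top_notMem_ker (χ : MVX A) : top A ∉ χ.ker.carrier := by
  intro h
  have h1 : χ.toFun (neg 0) = 0 := h
  rw [χ.map_neg, χ.map_zero] at h1
  have h2 := congrArg (Subtype.val) h1
  rw [coe_neg] at h2
  norm_num at h2

theorem ker_isPrime (χ : MVX A) : χ.ker.IsPrime := by
  refine ⟨top_notMem_ker χ, fun x y => ?_⟩
  have key : ∀ u v : A, (χ.toFun u : ℝ) ≤ χ.toFun v → ominus u v ∈ χ.ker.carrier := by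
    intro u v h
    change χ.toFun (ominus u v) = 0
    rw [ominus, neg_neg_eq, χ.map_neg, χ.map_oplus, χ.map_neg]
    apply Subtype.ext
    rw [coe_neg, coe_oplus, coe_neg, min_eq_left (by linarith)]
    simp
  exact (le_total (χ.toFun x : ℝ) (χ.toFun y)).imp (key x y) (key y x)

theorem coe_nmul (χ : MVX A) (a : A) (n : ℕ) :
    (χ.toFun (nmul n a) : ℝ) = min 1 (n * (χ.toFun a : ℝ)) := by
  induction n with
  | zero => simp [nmul, χ.map_zero]
  | succ n ih =>
    rw [nmul, χ.map_oplus, coe_oplus, ih]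
    have h0 := (χ.toFun a).2.1
    push_cast
    rcases min_cases 1 ((n : ℝ) * (χ.toFun a : ℝ)) with h | h
    · rw [h.1, min_eq_left (by linarith), min_eq_left (by linarith)]
    · rw [h.1]; ring_nf

theorem ker_isMaximal (χ : MVX A) : χ.ker.IsMaximal := by
  refine ⟨top_notMem_ker χ, fun J hJ h1 => ?_⟩
  refine MVIdeal.ext (Set.Subset.antisymm (fun a ha => ?_) hJ)
  by_contra hne
  have hpos : 0 < (χ.toFun a : ℝ) :=
    lt_of_le_of_ne (χ.toFun a).2.1 fun h => hne (Subtype.ext h.symm)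
  obtain ⟨n, hn⟩ := exists_nat_ge (1 / (χ.toFun a : ℝ))
  rw [div_le_iff₀ hpos] at hn
  have hmem : neg (nmul n a) ∈ J.carrier := by
    apply hJ
    change χ.toFun (neg (nmul n a)) = 0
    apply Subtype.ext
    rw [χ.map_neg, coe_neg, coe_nmul, min_eq_left hn]
    simp
  have hmul : ∀ m : ℕ, nmul m a ∈ J.carrier := by
    intro m
    induction m with
    | zero => exact J.zero_mem
    | succ m ih => exact J.oplus_mem _ _ ih ha
  have := J.oplus_mem _ _ hmem (hmul n)
  rw [neg_oplus_self] at this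
  exact h1 this

/-- `κ : X_A → Z_A`, `κ(χ) = ker χ`. -/
noncomputable def kappa (A : Type*) [MVAlgebra A] (χ : MVX A) : MVSpec A := ⟨χ.ker, ker_isPrime χ⟩

/-- `κ` as a map `X_A → M_A`. -/
noncomputable def kappaMax (A : Type*) [MVAlgebra A] (χ : MVX A) : MVMaxSpec A :=
  ⟨kappa A χ, ker_isMaximal χ⟩

end MVX

/-- Stone spaces: compact Hausdorff spaces with an open base of clopen sets. -/
def IsStoneSpace (X : Type*) [TopologicalSpace X] : Prop :=
  CompactSpace X ∧ T2Space X ∧ TopologicalSpace.IsTopologicalBasis {s : Set X | IsClopen s}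

/-!
The algebraic half rests on two facts about ideals.

* An ideal that is maximal among those avoiding a down-directed set `S` is prime
  (`MVIdeal.isPrime_of_maximal_avoiding`), because `x ⊖ y` and `y ⊖ x` are disjoint and adjoining
  disjoint elements to an ideal adds no common element. With `S = {1}` this says that maximal
  ideals are prime. With `S = {a ∧ ¬(n a) | n}` it produces, for a non-archimedean `a`, a prime ideal
  that is not maximal. Conversely, if some multiple `n a` is idempotent, then every prime ideal
  contains `a` or `¬(n a)`, so that a proper ideal above a prime `P` cannot contain any `a ∉ P`.
* Every maximal ideal is the kernel of exactly one morphism to `[0, 1]`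
  (`MVIdeal.IsMaximal.exists_ker_eq`, `MVX.ker_injective`). For existence, the quotient by a maximal
  ideal is a nontrivial chain `C`, and the value of `x` is the real number whose binary digits
  record whether `1` is reached when `x` is repeatedly doubled modulo `1`. Addition with carry on
  `ℕ × C` is associative (`MVAlgebra.carryAdd_assoc`), which shows that doubling both arguments
  doubles the defect of additivity of the value; the defect is bounded, so it vanishes. Uniqueness
  is the same doubling argument, applied to the difference of two morphisms.

In the coZariski topology every neighbourhood of a prime `P` contains all primes above `P`, so the
separation of points and the closedness of the `W_a` both force primes to be maximal, and two
distinct maximal ideals are always separated by some `W_a` and `W_{¬(n a)}`. The sections `â` are open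
embeddings, so the étale space is always a sheaf; `â` and `b̂` agree exactly on `W_{d(a, b)}`, which
links the Hausdorff property of the étale space with the closedness of the `W_a`. The space of
morphisms is compact, being closed in a cube, so `κ` is a homeomorphism onto the Hausdorff space of
maximal ideals as soon as it is continuous. Finally, if the maximal spectrum of a semisimple
algebra is compact, its cover by `W_a` and the `W_{¬(n a)}` has a finite subcover, and then
`a ∧ ¬(n a)` lies in all maximal ideals for some `n`, so it is zero and `a` is archimedean.
-/

/-! ### Order and residuation in an MV-algebra -/

namespace MVAlgebra

variable {A : Type*} [MVAlgebra A]

local infixl:65 " ⊕ₘ " => oplus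
local infixl:65 " ⊖ₘ " => ominus
local infix:50 " ≼ " => Le
local prefix:max "∼" => neg

instance : Std.Associative (oplus : A → A → A) := ⟨oplus_assoc⟩

instance : Std.Commutative (oplus : A → A → A) := ⟨oplus_comm⟩

theorem zero_oplus (x : A) : 0 ⊕ₘ x = x := by rw [oplus_comm, oplus_zero]

theorem neg_zero_oplus (x : A) : ∼0 ⊕ₘ x = ∼0 := by rw [oplus_comm, oplus_neg_zero]

theorem ominus_eq (x y : A) : x ⊖ₘ y = ∼(∼x ⊕ₘ y) := by rw [ominus, neg_neg_eq]

theorem ominus_zero (x : A) : x ⊖ₘ 0 = x := by rw [ominus_eq, oplus_zero, neg_neg_eq]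

theorem zero_ominus (x : A) : 0 ⊖ₘ x = 0 := by rw [ominus_eq, neg_zero_oplus, neg_neg_eq]

theorem distance_zero (x : A) : distance x 0 = x := by
  rw [distance, ominus_zero, zero_ominus, oplus_zero]

/-- Both sides are the join of `x` and `y`. -/
theorem ominus_oplus_comm (x y : A) : (x ⊖ₘ y) ⊕ₘ y = (y ⊖ₘ x) ⊕ₘ x := by
  rw [ominus_eq, ominus_eq, lukasiewicz]

theorem le_iff {x y : A} : x ≼ y ↔ ∼x ⊕ₘ y = ∼0 := by
  constructor
  · rintro ⟨z, rfl⟩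
    rw [← oplus_assoc, neg_oplus_self, neg_zero_oplus]
  · intro h
    refine ⟨y ⊖ₘ x, ?_⟩
    rw [oplus_comm, ominus_oplus_comm, ominus_eq, h, neg_neg_eq, zero_oplus]

theorem ominus_eq_zero_iff {x y : A} : x ⊖ₘ y = 0 ↔ x ≼ y := by
  rw [le_iff, ominus_eq]
  constructor
  · intro h
    rw [← h, neg_neg_eq]
  · intro h
    rw [h, neg_neg_eq]

theorem le_refl (x : A) : x ≼ x := ⟨0, oplus_zero x⟩

theorem le_trans {x y z : A} (h : x ≼ y) (h' : y ≼ z) : x ≼ z := by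
  obtain ⟨u, rfl⟩ := h
  obtain ⟨v, rfl⟩ := h'
  exact ⟨u ⊕ₘ v, (oplus_assoc _ _ _).symm⟩

theorem ominus_oplus_cancel {x y : A} (h : y ≼ x) : (x ⊖ₘ y) ⊕ₘ y = x := by
  rw [ominus_oplus_comm, ominus_eq_zero_iff.2 h, zero_oplus]

theorem le_antisymm {x y : A} (h : x ≼ y) (h' : y ≼ x) : x = y := by
  rw [← ominus_oplus_cancel h', ominus_eq_zero_iff.2 h, zero_oplus]

theorem zero_le (x : A) : 0 ≼ x := ⟨x, zero_oplus x⟩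

theorem le_neg_zero (x : A) : x ≼ ∼0 := ⟨∼0, oplus_neg_zero x⟩

theorem eq_zero_of_le {x : A} (h : x ≼ 0) : x = 0 := le_antisymm h (zero_le x)

theorem eq_neg_zero_of_le {x : A} (h : ∼0 ≼ x) : x = ∼0 := le_antisymm (le_neg_zero x) h

theorem le_oplus_left (x y : A) : x ≼ x ⊕ₘ y := ⟨y, rfl⟩

theorem le_oplus_right (x y : A) : y ≼ x ⊕ₘ y := ⟨x, oplus_comm _ _⟩

theorem oplus_le_oplus {x y z w : A} (h : x ≼ y) (h' : z ≼ w) : x ⊕ₘ z ≼ y ⊕ₘ w := by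
  obtain ⟨u, rfl⟩ := h
  obtain ⟨v, rfl⟩ := h'
  exact ⟨u ⊕ₘ v, by ac_rfl⟩

theorem neg_le_neg {x y : A} (h : x ≼ y) : ∼y ≼ ∼x := by
  rw [le_iff, neg_neg_eq, oplus_comm]
  exact le_iff.1 h

theorem le_neg_comm {x y : A} (h : x ≼ ∼y) : y ≼ ∼x := by
  simpa only [neg_neg_eq] using neg_le_neg h

theorem oplus_eq_neg_zero_iff {x y : A} : x ⊕ₘ y = ∼0 ↔ ∼x ≼ y := by
  rw [le_iff, neg_neg_eq]

/-- Truncated subtraction is residuated with addition. -/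
theorem ominus_le_iff {x y z : A} : x ⊖ₘ y ≼ z ↔ x ≼ z ⊕ₘ y := by
  rw [le_iff, le_iff, ominus_eq, neg_neg_eq, oplus_assoc, oplus_comm y z]

theorem ominus_le_self (x y : A) : x ⊖ₘ y ≼ x := ominus_le_iff.2 (le_oplus_left x y)

theorem ominus_le_neg (x y : A) : x ⊖ₘ y ≼ ∼y := by
  rw [ominus_eq]
  exact neg_le_neg (le_oplus_right _ _)

theorem ominus_le_ominus {x y : A} (h : x ≼ y) (z : A) : x ⊖ₘ z ≼ y ⊖ₘ z := by
  rw [ominus_eq, ominus_eq]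
  exact neg_le_neg (oplus_le_oplus (neg_le_neg h) (le_refl z))

/-- `(x ⊖ y) ⊕ y` is the least upper bound of `x` and `y`. -/
theorem ominus_oplus_le {x y z : A} (hx : x ≼ z) (hy : y ≼ z) : (x ⊖ₘ y) ⊕ₘ y ≼ z := by
  have h := oplus_le_oplus (ominus_le_ominus hx y) (le_refl y)
  rwa [ominus_oplus_cancel hy] at h

theorem oplus_ominus_cancel {x y : A} (h : x ≼ ∼y) : (x ⊕ₘ y) ⊖ₘ y = x := by
  have h1 := ominus_oplus_cancel (le_neg_comm h)
  rw [ominus_eq, neg_neg_eq] at h1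
  rw [ominus_eq, h1, neg_neg_eq]

/-- The meet `x ∧ y = y ⊖ (y ⊖ x)`. -/
def meet (x y : A) : A := y ⊖ₘ (y ⊖ₘ x)

theorem meet_le_left (x y : A) : meet x y ≼ x := by
  rw [meet, ominus_le_iff, oplus_comm, ominus_oplus_comm]
  exact le_oplus_right _ _

theorem meet_le_right (x y : A) : meet x y ≼ y := ominus_le_self _ _

theorem le_meet {x y z : A} (hx : z ≼ x) (hy : z ≼ y) : z ≼ meet x y := by
  have h := ominus_oplus_le (neg_le_neg hx) (neg_le_neg hy)
  have h1 : ∼x ⊖ₘ ∼y = y ⊖ₘ x := by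
    rw [ominus_eq, ominus_eq, neg_neg_eq, oplus_comm]
  rw [h1, oplus_comm] at h
  rw [meet, ominus_eq y (y ⊖ₘ x)]
  exact le_neg_comm h

/-- `u` and `v` are disjoint, `u ∧ v = 0`, expressed through their common lower bounds. -/
def IsDisjoint (u v : A) : Prop := ∀ t : A, t ≼ u → t ≼ v → t = 0

theorem IsDisjoint.symm {u v : A} (h : IsDisjoint u v) : IsDisjoint v u :=
  fun t h1 h2 => h t h2 h1

theorem IsDisjoint.oplus {u v w : A} (hv : IsDisjoint u v) (hw : IsDisjoint u w) :
    IsDisjoint u (v ⊕ₘ w) := by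
  intro t hu hvw
  refine hv t hu (ominus_eq_zero_iff.1 (hw _ (le_trans (ominus_le_self t v) hu) ?_))
  rwa [ominus_le_iff, oplus_comm]

theorem IsDisjoint.nmul_right {u v : A} (h : IsDisjoint u v) (n : ℕ) :
    IsDisjoint u (nmul n v) := by
  induction n with
  | zero => exact fun t _ h2 => eq_zero_of_le h2
  | succ n ih => exact ih.oplus h

theorem isDisjoint_ominus (x y : A) : IsDisjoint (x ⊖ₘ y) (y ⊖ₘ x) := by
  intro t hx hy
  -- with `m = x ∧ y`, both `x` and `y` are above `m ⊕ t`, hence so is `m`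
  have key : ∀ {u v : A}, t ≼ v ⊖ₘ u → meet u v ⊕ₘ t ≼ v := fun {u v} h => by
    have h1 := oplus_le_oplus (le_refl (meet u v)) h
    rwa [meet, ominus_oplus_cancel (ominus_le_self v u)] at h1
  have hm : meet y x = meet x y :=
    le_antisymm (le_meet (meet_le_right _ _) (meet_le_left _ _))
      (le_meet (meet_le_right _ _) (meet_le_left _ _))
  have h1 : t ⊕ₘ meet x y ≼ 0 ⊕ₘ meet x y := by
    rw [oplus_comm, zero_oplus]
    exact le_meet (hm ▸ key hx) (key hy)
  have h2 : t ≼ ∼(meet x y) :=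
    le_trans (le_trans hx (ominus_le_neg _ _)) (neg_le_neg (meet_le_right _ _))
  rw [← ominus_le_iff, oplus_ominus_cancel h2] at h1
  exact eq_zero_of_le h1

theorem nmul_add (m n : ℕ) (a : A) : nmul (m + n) a = nmul m a ⊕ₘ nmul n a := by
  induction n with
  | zero => exact (oplus_zero _).symm
  | succ n ih => rw [← Nat.add_assoc, nmul, nmul, ih, oplus_assoc]

theorem nmul_le_nmul {m n : ℕ} (h : m ≤ n) (a : A) : nmul m a ≼ nmul n a := by
  obtain ⟨k, rfl⟩ := Nat.exists_eq_add_of_le h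
  rw [nmul_add]
  exact le_oplus_left _ _

theorem le_nmul {n : ℕ} (h : 1 ≤ n) (a : A) : a ≼ nmul n a := by
  have h1 := nmul_le_nmul h a
  rwa [nmul, nmul, zero_oplus] at h1

/-- If `a` is disjoint from `¬(n a)` then the multiples of `a` are stationary from `n` on. -/
theorem nmul_eq_of_isDisjoint {a : A} {n : ℕ} (h : IsDisjoint a ∼(nmul n a)) :
    nmul n a = nmul (n + 1) a := by
  refine le_antisymm (le_oplus_left _ _) (ominus_eq_zero_iff.1 (h _ ?_ (ominus_le_neg _ _)))
  rw [ominus_le_iff, oplus_comm]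
  exact le_refl _

theorem IsArchimedean.of_isDisjoint {a : A} {n : ℕ} (h : IsDisjoint a ∼(nmul n a)) :
    IsArchimedean a := by
  refine ⟨n + 1, by omega, ?_⟩
  have h1 := nmul_eq_of_isDisjoint h
  change _ = nmul (n + 1) a ⊕ₘ a
  rw [← h1]
  exact h1

/-- An archimedean element has an idempotent multiple. -/
theorem IsArchimedean.exists_idempotent {a : A} (h : IsArchimedean a) :
    ∃ n : ℕ, 1 ≤ n ∧ nmul n a ⊕ₘ nmul n a = nmul n a := by
  obtain ⟨n, hn, h1⟩ := h
  have h2 : ∀ k : ℕ, nmul (n + k) a = nmul n a := by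
    intro k
    induction k with
    | zero => rfl
    | succ k ih => rw [← Nat.add_assoc, nmul, ih, ← nmul, h1]
  exact ⟨n, hn, by rw [← nmul_add, h2]⟩

end MVAlgebra

/-! ### Prime ideals avoiding a down-directed set -/

namespace MVIdeal

open MVAlgebra

variable {A : Type*} [MVAlgebra A]

local infixl:65 " ⊕ₘ " => oplus
local infixl:65 " ⊖ₘ " => ominus
local infix:50 " ≼ " => Le
local prefix:max "∼" => neg

theorem nmul_mem (I : MVIdeal A) {a : A} (h : a ∈ I.carrier) (n : ℕ) :
    nmul n a ∈ I.carrier := by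
  induction n with
  | zero => exact I.zero_mem
  | succ n ih => exact I.oplus_mem _ _ ih h

theorem oplus_mem_iff (I : MVIdeal A) {a b : A} :
    a ⊕ₘ b ∈ I.carrier ↔ a ∈ I.carrier ∧ b ∈ I.carrier :=
  ⟨fun h => ⟨I.down_closed _ _ h (le_oplus_left a b), I.down_closed _ _ h (le_oplus_right a b)⟩,
    fun h => I.oplus_mem _ _ h.1 h.2⟩

/-- The ideal generated by an ideal `I` and an element `u`. -/
def adjoin (I : MVIdeal A) (u : A) : MVIdeal A where
  carrier := {x | ∃ p ∈ I.carrier, ∃ n : ℕ, x ≼ p ⊕ₘ nmul n u}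
  zero_mem := ⟨0, I.zero_mem, 0, zero_le _⟩
  down_closed := by
    rintro x y ⟨p, hp, n, h⟩ hy
    exact ⟨p, hp, n, le_trans hy h⟩
  oplus_mem := by
    rintro x y ⟨p, hp, n, h⟩ ⟨q, hq, m, h'⟩
    refine ⟨p ⊕ₘ q, I.oplus_mem _ _ hp hq, n + m, ?_⟩
    have h1 : p ⊕ₘ q ⊕ₘ nmul (n + m) u = (p ⊕ₘ nmul n u) ⊕ₘ (q ⊕ₘ nmul m u) := by
      rw [nmul_add]
      ac_rfl
    rw [h1]
    exact oplus_le_oplus h h'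

theorem subset_adjoin (I : MVIdeal A) (u : A) : I.carrier ⊆ (I.adjoin u).carrier :=
  fun p hp => ⟨p, hp, 0, le_oplus_left _ _⟩

theorem mem_adjoin_self (I : MVIdeal A) (u : A) : u ∈ (I.adjoin u).carrier :=
  ⟨0, I.zero_mem, 1, by rw [zero_oplus]; exact le_nmul le_rfl u⟩

/-- Adjoining two disjoint elements separately adds no common element. -/
theorem mem_of_mem_adjoin {I : MVIdeal A} {u v x : A} (h : IsDisjoint u v)
    (hu : x ∈ (I.adjoin u).carrier) (hv : x ∈ (I.adjoin v).carrier) : x ∈ I.carrier := by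
  obtain ⟨p, hp, n, hn⟩ := hu
  obtain ⟨q, hq, m, hm⟩ := hv
  have h1 : IsDisjoint (nmul n u) (nmul m v) := (h.symm.nmul_right n).symm.nmul_right m
  refine I.down_closed _ _ (I.oplus_mem _ _ hp hq)
    (ominus_eq_zero_iff.1 (h1 _ (ominus_le_iff.2 ?_) (ominus_le_iff.2 ?_)))
  · refine le_trans hn ?_
    rw [oplus_comm p]
    exact oplus_le_oplus (le_refl _) (le_oplus_left _ _)
  · refine le_trans hm ?_
    rw [oplus_comm q]
    exact oplus_le_oplus (le_refl _) (le_oplus_right _ _)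

/-- An ideal that is maximal among those avoiding a nonempty down-directed set is prime. -/
theorem isPrime_of_maximal_avoiding {P : MVIdeal A} {S : Set A} (hne : S.Nonempty)
    (hdir : ∀ s ∈ S, ∀ t ∈ S, ∃ w ∈ S, w ≼ s ∧ w ≼ t) (hP : ∀ s ∈ S, s ∉ P.carrier)
    (hmax : ∀ J : MVIdeal A, P.carrier ⊆ J.carrier → (∀ s ∈ S, s ∉ J.carrier) → J = P) :
    P.IsPrime := by
  have key : ∀ u : A, u ∉ P.carrier → ∃ s ∈ S, s ∈ (P.adjoin u).carrier := by
    intro u hu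
    by_contra! h
    have h1 := hmax _ (P.subset_adjoin u) h
    exact hu (h1 ▸ P.mem_adjoin_self u)
  refine ⟨fun h => ?_, fun x y => ?_⟩
  · obtain ⟨s, hs⟩ := hne
    exact hP s hs (P.down_closed _ _ h (le_neg_zero s))
  · by_contra! h
    obtain ⟨s, hs, hs'⟩ := key _ h.1
    obtain ⟨t, ht, ht'⟩ := key _ h.2
    obtain ⟨w, hw, hws, hwt⟩ := hdir s hs t ht
    exact hP w hw (mem_of_mem_adjoin (isDisjoint_ominus x y)
      ((P.adjoin _).down_closed _ _ hs' hws) ((P.adjoin _).down_closed _ _ ht' hwt))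

theorem IsMaximal.isPrime {M : MVIdeal A} (h : M.IsMaximal) : M.IsPrime := by
  refine isPrime_of_maximal_avoiding (S := {top A}) ⟨_, rfl⟩ ?_ ?_ ?_
  · rintro s rfl t rfl
    exact ⟨_, rfl, le_refl _, le_refl _⟩
  · rintro s rfl
    exact h.1
  · exact fun J hJ hJ' => h.2 J hJ (hJ' _ rfl)

/-- The prime ideal theorem: a nonempty down-directed set without `0` is avoided by a prime. -/
theorem exists_isPrime_avoiding {S : Set A} (hne : S.Nonempty)
    (hdir : ∀ s ∈ S, ∀ t ∈ S, ∃ w ∈ S, w ≼ s ∧ w ≼ t) (h0 : (0 : A) ∉ S) :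
    ∃ P : MVIdeal A, P.IsPrime ∧ ∀ s ∈ S, s ∉ P.carrier := by
  obtain ⟨m, -, ⟨⟨P, rfl, hP⟩, hmax⟩⟩ := zorn_subset_nonempty
    {c : Set A | ∃ I : MVIdeal A, I.carrier = c ∧ ∀ s ∈ S, s ∉ I.carrier} (by
      intro c hc hchain hcne
      refine ⟨⋃₀ c, ⟨⟨⋃₀ c, ?_, ?_, ?_⟩, rfl, ?_⟩, fun s hs => Set.subset_sUnion_of_mem hs⟩
      · obtain ⟨s, hs⟩ := hcne
        obtain ⟨I, rfl, -⟩ := hc hs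
        exact ⟨_, hs, I.zero_mem⟩
      · rintro x y ⟨s, hs, hx⟩ hy
        obtain ⟨I, rfl, -⟩ := hc hs
        exact ⟨_, hs, I.down_closed _ _ hx hy⟩
      · rintro x y ⟨s, hs, hx⟩ ⟨t, ht, hy⟩
        obtain ⟨r, hr, hsr, htr⟩ := hchain.directedOn s hs t ht
        obtain ⟨I, rfl, -⟩ := hc hr
        exact ⟨_, hr, I.oplus_mem _ _ (hsr hx) (htr hy)⟩
      · rintro x hx ⟨s, hs, hxs⟩
        obtain ⟨I, rfl, hI⟩ := hc hs
        exact hI x hx hxs) {0}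
    ⟨⟨{0}, rfl, by rintro x y rfl h; exact eq_zero_of_le h,
      by rintro x y rfl rfl; exact oplus_zero 0⟩, rfl, by rintro s hs rfl; exact h0 hs⟩
  refine ⟨P, isPrime_of_maximal_avoiding hne hdir hP fun J hJ hJ' => ?_, hP⟩
  exact MVIdeal.ext (Set.Subset.antisymm (hmax ⟨J, rfl, hJ'⟩ hJ) hJ)

/-- A maximal ideal not containing `a` contains some `¬(n a)`. -/
theorem IsMaximal.exists_neg_nmul_mem {M : MVIdeal A} (h : M.IsMaximal) {a : A}
    (ha : a ∉ M.carrier) : ∃ n : ℕ, ∼(nmul n a) ∈ M.carrier := by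
  have h1 : top A ∈ (M.adjoin a).carrier := by
    by_contra hne
    exact ha (h.2 _ (M.subset_adjoin a) hne ▸ M.mem_adjoin_self a)
  obtain ⟨p, hp, n, hn⟩ := h1
  refine ⟨n, M.down_closed _ _ hp ?_⟩
  rw [← oplus_eq_neg_zero_iff, oplus_comm]
  exact eq_neg_zero_of_le hn

theorem IsPrime.of_subset {P J : MVIdeal A} (h : P.IsPrime) (hPJ : P.carrier ⊆ J.carrier)
    (hJ : top A ∉ J.carrier) : J.IsPrime :=
  ⟨hJ, fun x y => (h.2 x y).imp (fun h => hPJ h) (fun h => hPJ h)⟩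

/-- A prime ideal contains an idempotent or its complement. -/
theorem IsPrime.mem_or_neg_mem {P : MVIdeal A} (h : P.IsPrime) {b : A} (hb : b ⊕ₘ b = b) :
    b ∈ P.carrier ∨ ∼b ∈ P.carrier := by
  refine (h.2 b ∼b).imp (fun h1 => P.down_closed _ _ h1 ?_) (fun h1 => ?_)
  · -- `b ≤ b ⊖ ¬b` since `(b ⊖ ¬b) ⊕ ¬b` is the join of `b` and `¬b`, which is `1`
    rw [le_iff, oplus_comm, ominus_oplus_comm, ominus_eq, neg_neg_eq, hb, neg_oplus_self]
  · rwa [ominus_eq, neg_neg_eq, hb] at h1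

/-- The multiples of a non-archimedean `a` give a decreasing sequence `a ∧ ¬(n a)` of nonzero
elements; a prime avoiding all of them cannot be maximal. -/
theorem isHyperarchimedean_of_isPrime_isMaximal
    (h : ∀ P : MVIdeal A, P.IsPrime → P.IsMaximal) : IsHyperarchimedean A := by
  intro a
  by_contra ha
  obtain ⟨P, hP, hS⟩ := exists_isPrime_avoiding
    (S := Set.range fun n : ℕ => meet a ∼(nmul n a)) ⟨_, 0, rfl⟩ (by
      rintro _ ⟨n, rfl⟩ _ ⟨m, rfl⟩
      exact ⟨_, ⟨max n m, rfl⟩,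
        le_meet (meet_le_left _ _)
          (le_trans (meet_le_right _ _) (neg_le_neg (nmul_le_nmul (le_max_left n m) a))),
        le_meet (meet_le_left _ _)
          (le_trans (meet_le_right _ _) (neg_le_neg (nmul_le_nmul (le_max_right n m) a)))⟩) (by
      rintro ⟨n, hn⟩
      refine ha (IsArchimedean.of_isDisjoint (n := n) fun t h1 h2 => ?_)
      have h3 := le_meet h1 h2
      dsimp only at hn
      rw [hn] at h3
      exact eq_zero_of_le h3)
  have haP : a ∉ P.carrier := fun hmem =>
    hS _ ⟨0, rfl⟩ (P.down_closed _ _ hmem (meet_le_left _ _))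
  obtain ⟨n, hn⟩ := (h P hP).exists_neg_nmul_mem haP
  exact hS _ ⟨n, rfl⟩ (P.down_closed _ _ hn (meet_le_right _ _))

theorem IsPrime.isMaximal {P : MVIdeal A} (hP : P.IsPrime) (hA : IsHyperarchimedean A) :
    P.IsMaximal := by
  refine ⟨hP.1, fun J hPJ hJ => MVIdeal.ext (Set.Subset.antisymm (fun a ha => ?_) hPJ)⟩
  obtain ⟨n, hn, hb⟩ := (hA a).exists_idempotent
  rcases hP.mem_or_neg_mem hb with h | h
  · exact P.down_closed _ _ h (le_nmul hn a)
  · refine absurd (J.oplus_mem _ _ (hPJ h) (J.nmul_mem ha n)) ?_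
    rw [neg_oplus_self]
    exact hJ

end MVIdeal

/-! ### Addition with carry in an MV-chain -/

namespace MVAlgebra

variable {A : Type*} [MVAlgebra A]

local infixl:65 " ⊕ₘ " => oplus
local infixl:65 " ⊖ₘ " => ominus
local infix:50 " ≼ " => Le
local prefix:max "∼" => neg

/-- The product `x ⊙ y = ¬(¬x ⊕ ¬y)`, that is `max(0, x + y - 1)` in `[0, 1]`. -/
def otimes (x y : A) : A := ∼(∼x ⊕ₘ ∼y)

local infixl:70 " ⊙ₘ " => otimes

theorem otimes_eq (x y : A) : x ⊙ₘ y = x ⊖ₘ ∼y := (ominus_eq x ∼y).symm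

theorem otimes_comm (x y : A) : x ⊙ₘ y = y ⊙ₘ x := by rw [otimes, otimes, oplus_comm]

theorem otimes_assoc (x y z : A) : x ⊙ₘ y ⊙ₘ z = x ⊙ₘ (y ⊙ₘ z) := by
  simp only [otimes, neg_neg_eq, oplus_assoc]

theorem otimes_le_left (x y : A) : x ⊙ₘ y ≼ x := by
  rw [otimes_eq]
  exact ominus_le_self _ _

theorem oplus_otimes_of_le {a b d : A} (hab : a ≼ ∼b) (hbd : b ⊕ₘ d = ∼0) :
    a ⊕ₘ (b ⊙ₘ d) = (a ⊕ₘ b) ⊙ₘ d := by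
  have hd : ∼d ≼ b := oplus_eq_neg_zero_iff.1 (by rwa [oplus_comm])
  have hb : ∼b ≼ d := oplus_eq_neg_zero_iff.1 hbd
  -- write `b = g ⊕ ¬d` with `g = b ⊙ d`, and cancel `¬d`
  have hg : (b ⊙ₘ d) ⊕ₘ ∼d = b := by rw [otimes_eq, ominus_oplus_cancel hd]
  have hle : a ⊕ₘ (b ⊙ₘ d) ≼ ∼∼d := by
    rw [neg_neg_eq]
    have h1 := oplus_le_oplus hab (le_refl (b ⊙ₘ d))
    have h2 : ∼b ⊕ₘ (b ⊙ₘ d) = d := by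
      rw [otimes_comm b d, otimes_eq d b, oplus_comm (∼b), ominus_oplus_cancel hb]
    rwa [h2] at h1
  rw [otimes_eq (a ⊕ₘ b) d]
  nth_rw 2 [← hg]
  rw [← oplus_assoc, oplus_ominus_cancel hle]

theorem otimes_oplus_of_le {a b d : A} (hab : a ≼ ∼b) (hbd : b ≼ ∼d)
    (h : ∼(b ⊕ₘ d) ≼ a) : (a ⊕ₘ b) ⊙ₘ d = a ⊙ₘ (b ⊕ₘ d) := by
  -- `¬d = f ⊕ b` and `a = (a ⊙ (b ⊕ d)) ⊕ f` with `f = ¬(b ⊕ d)`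
  have hf : ∼(b ⊕ₘ d) ⊕ₘ b = ∼d := by
    have h1 := ominus_oplus_cancel hbd
    rwa [ominus_eq, neg_neg_eq, oplus_comm d b] at h1
  have ha : a ⊙ₘ (b ⊕ₘ d) ⊕ₘ ∼(b ⊕ₘ d) = a := by rw [otimes_eq, ominus_oplus_cancel h]
  have hle : a ⊙ₘ (b ⊕ₘ d) ≼ ∼∼d := by
    rw [neg_neg_eq, otimes_eq, ominus_le_iff]
    have h1 : ∼b ≼ d ⊕ₘ ∼(b ⊕ₘ d) := by
      have h2 := le_oplus_right (d ⊖ₘ ∼b) (∼b)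
      rw [ominus_oplus_comm, ominus_eq, neg_neg_eq, oplus_comm] at h2
      exact h2
    exact le_trans hab h1
  rw [otimes_eq (a ⊕ₘ b) d]
  nth_rw 1 [← ha]
  rw [oplus_assoc, hf, oplus_ominus_cancel hle]

open Classical in
/-- The carry of the sum `x + y`: whether `x ⊕ y` reaches `1`. -/
noncomputable def carry (x y : A) : ℕ := if x ⊕ₘ y = ∼0 then 1 else 0

open Classical in
/-- The part of the sum `x + y` that remains after the carry. -/
noncomputable def residue (x y : A) : A := if x ⊕ₘ y = ∼0 then x ⊙ₘ y else x ⊕ₘ y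

theorem carry_of_eq {x y : A} (h : x ⊕ₘ y = ∼0) : carry x y = 1 := if_pos h

theorem carry_of_ne {x y : A} (h : x ⊕ₘ y ≠ ∼0) : carry x y = 0 := if_neg h

theorem residue_of_eq {x y : A} (h : x ⊕ₘ y = ∼0) : residue x y = x ⊙ₘ y := if_pos h

theorem residue_of_ne {x y : A} (h : x ⊕ₘ y ≠ ∼0) : residue x y = x ⊕ₘ y := if_neg h

theorem carry_comm (x y : A) : carry x y = carry y x := by rw [carry, carry, oplus_comm]

theorem residue_comm (x y : A) : residue x y = residue y x := by
  rw [residue, residue, oplus_comm, otimes_comm]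

/-- Addition of pairs `(n, x)`, thought of as `n + x`, with carry into the first component. -/
noncomputable def carryAdd (p q : ℕ × A) : ℕ × A :=
  (p.1 + q.1 + carry p.2 q.2, residue p.2 q.2)

theorem carryAdd_comm (p q : ℕ × A) : carryAdd p q = carryAdd q p := by
  rw [carryAdd, carryAdd, carry_comm, residue_comm, Nat.add_comm p.1]

theorem le_neg_of_oplus_ne (hA : ∀ x y : A, x ≼ y ∨ y ≼ x) {x y : A} (h : x ⊕ₘ y ≠ ∼0) :
    x ≼ ∼y := by
  refine (hA x ∼y).resolve_right fun h1 => h ?_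
  rw [oplus_comm]
  exact oplus_eq_neg_zero_iff.2 h1

/-- Associativity of `carryAdd` when the inner sum on one side has no carry and the other has. -/
theorem carry_residue_assoc_of_ne_of_eq (hA : ∀ x y : A, x ≼ y ∨ y ≼ x) {a b d : A}
    (hab : a ⊕ₘ b ≠ ∼0) (hbd : b ⊕ₘ d = ∼0) :
    carry a b + carry (residue a b) d = carry b d + carry a (residue b d) ∧
      residue (residue a b) d = residue a (residue b d) := by
  have h1 : a ⊕ₘ b ⊕ₘ d = ∼0 := by rw [oplus_assoc, hbd, oplus_neg_zero]
  have h2 : a ⊕ₘ (b ⊙ₘ d) ≠ ∼0 := fun h => hab (eq_neg_zero_of_le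
    (h ▸ oplus_le_oplus (le_refl a) (otimes_le_left b d)))
  rw [carry_of_ne hab, residue_of_ne hab, carry_of_eq hbd, residue_of_eq hbd, carry_of_eq h1,
    residue_of_eq h1, carry_of_ne h2, residue_of_ne h2,
    oplus_otimes_of_le (le_neg_of_oplus_ne hA hab) hbd]
  exact ⟨rfl, rfl⟩

theorem otimes_oplus_eq_oplus_otimes (hA : ∀ x y : A, x ≼ y ∨ y ≼ x) {a b d : A}
    (hab : a ⊕ₘ b = ∼0) (hbd : b ⊕ₘ d = ∼0) (h : a ⊕ₘ (b ⊙ₘ d) ≠ ∼0) :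
    a ⊙ₘ b ⊕ₘ d = a ⊕ₘ (b ⊙ₘ d) := by
  -- the dual of `otimes_oplus_of_le`
  have h1 := otimes_oplus_of_le (a := ∼a) (b := ∼b) (d := ∼d)
    (by rw [neg_neg_eq]; exact oplus_eq_neg_zero_iff.1 hab)
    (by rw [neg_neg_eq]; exact oplus_eq_neg_zero_iff.1 hbd)
    (le_neg_comm (le_neg_of_oplus_ne hA h))
  have h2 := congrArg neg h1
  simpa only [otimes, neg_neg_eq] using h2

theorem carry_residue_assoc (hA : ∀ x y : A, x ≼ y ∨ y ≼ x) (a b d : A) :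
    carry a b + carry (residue a b) d = carry b d + carry a (residue b d) ∧
      residue (residue a b) d = residue a (residue b d) := by
  by_cases hab : a ⊕ₘ b = ∼0 <;> by_cases hbd : b ⊕ₘ d = ∼0
  · have key : a ⊙ₘ b ⊕ₘ d ≠ ∼0 → a ⊙ₘ b ⊕ₘ d = a ⊕ₘ (b ⊙ₘ d) := by
      intro h
      have h1 := otimes_oplus_eq_oplus_otimes hA (a := d) (b := b) (d := a)
        (by rwa [oplus_comm]) (by rwa [oplus_comm]) (by rwa [oplus_comm, otimes_comm])
      rw [oplus_comm _ d, otimes_comm a b, ← h1, oplus_comm a, otimes_comm d b]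
    rw [carry_of_eq hab, residue_of_eq hab, carry_of_eq hbd, residue_of_eq hbd]
    by_cases h : a ⊕ₘ (b ⊙ₘ d) = ∼0
    · have h1 : a ⊙ₘ b ⊕ₘ d = ∼0 := by
        by_contra h1
        exact h1 ((key h1).trans h)
      rw [carry_of_eq h, carry_of_eq h1, residue_of_eq h, residue_of_eq h1, otimes_assoc]
      exact ⟨rfl, rfl⟩
    · have h1 := otimes_oplus_eq_oplus_otimes hA hab hbd h
      have h2 : a ⊙ₘ b ⊕ₘ d ≠ ∼0 := h1 ▸ h
      rw [carry_of_ne h, carry_of_ne h2, residue_of_ne h, residue_of_ne h2, h1]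
      exact ⟨rfl, rfl⟩
  · have h1 := carry_residue_assoc_of_ne_of_eq hA (a := d) (b := b) (d := a)
      (by rwa [oplus_comm]) (by rwa [oplus_comm])
    rw [carry_comm d b, residue_comm d b, carry_comm b a, residue_comm b a,
      carry_comm _ a, carry_comm d, residue_comm _ a, residue_comm d] at h1
    exact ⟨h1.1.symm, h1.2.symm⟩
  · exact carry_residue_assoc_of_ne_of_eq hA hab hbd
  · rw [carry_of_ne hab, residue_of_ne hab, carry_of_ne hbd, residue_of_ne hbd]
    have hassoc := oplus_assoc a b d
    by_cases h : a ⊕ₘ (b ⊕ₘ d) = ∼0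
    · have h1 : a ⊕ₘ b ⊕ₘ d = ∼0 := hassoc.trans h
      rw [carry_of_eq h, carry_of_eq h1, residue_of_eq h, residue_of_eq h1]
      refine ⟨rfl, otimes_oplus_of_le (le_neg_of_oplus_ne hA hab) (le_neg_of_oplus_ne hA hbd) ?_⟩
      exact oplus_eq_neg_zero_iff.1 (by rwa [oplus_comm])
    · have h1 : a ⊕ₘ b ⊕ₘ d ≠ ∼0 := fun h1 => h (hassoc.symm.trans h1)
      rw [carry_of_ne h, carry_of_ne h1, residue_of_ne h, residue_of_ne h1, hassoc]
      exact ⟨rfl, rfl⟩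

theorem carryAdd_assoc (hA : ∀ x y : A, x ≼ y ∨ y ≼ x) (p q r : ℕ × A) :
    carryAdd (carryAdd p q) r = carryAdd p (carryAdd q r) := by
  obtain ⟨h1, h2⟩ := carry_residue_assoc hA p.2 q.2 r.2
  refine Prod.ext ?_ h2
  simp only [carryAdd]
  omega

/-! ### The morphism from an MV-chain to the unit interval -/

/-- The real number whose binary digits are the carries met when `x` is repeatedly doubled. -/
noncomputable def binaryValue (x : A) : ℝ :=
  ∑' k : ℕ, (carry ((fun y => residue y y)^[k] x) ((fun y => residue y y)^[k] x) : ℝ) *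
    (1 / 2) ^ (k + 1)

theorem carry_le_one (x y : A) : carry x y ≤ 1 := by
  rw [carry]
  split_ifs <;> omega

theorem hasSum_half_pow_succ : HasSum (fun k : ℕ => (1 / 2 : ℝ) ^ (k + 1)) 1 := by
  have h := hasSum_geometric_two.mul_right (1 / 2 : ℝ)
  rw [show (2 : ℝ) * (1 / 2) = 1 by norm_num] at h
  exact h

theorem binaryTerm_le (x : A) (k : ℕ) :
    (carry ((fun y => residue y y)^[k] x) ((fun y => residue y y)^[k] x) : ℝ) *
      (1 / 2) ^ (k + 1) ≤ (1 / 2) ^ (k + 1) :=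
  mul_le_of_le_one_left (by positivity) (by exact_mod_cast carry_le_one _ _)

theorem summable_binaryTerm (x : A) : Summable fun k : ℕ =>
    (carry ((fun y => residue y y)^[k] x) ((fun y => residue y y)^[k] x) : ℝ) *
      (1 / 2) ^ (k + 1) :=
  Summable.of_nonneg_of_le (fun k => by positivity) (binaryTerm_le x)
    hasSum_half_pow_succ.summable

theorem binaryValue_nonneg (x : A) : 0 ≤ binaryValue x :=
  tsum_nonneg fun k => by positivity

theorem binaryValue_le_one (x : A) : binaryValue x ≤ 1 :=
  ((summable_binaryTerm x).tsum_le_tsum (binaryTerm_le x)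
    hasSum_half_pow_succ.summable).trans_eq hasSum_half_pow_succ.tsum_eq

theorem two_mul_binaryValue (x : A) :
    2 * binaryValue x = carry x x + binaryValue (residue x x) := by
  have h : binaryValue x = (carry x x : ℝ) * (1 / 2) ^ (0 + 1) +
      ∑' k : ℕ, (carry ((fun y => residue y y)^[k] (residue x x))
        ((fun y => residue y y)^[k] (residue x x)) : ℝ) * (1 / 2) ^ (k + 1 + 1) :=
    (summable_binaryTerm x).tsum_eq_zero_add
  have h1 : ∑' k : ℕ, (carry ((fun y => residue y y)^[k] (residue x x))
      ((fun y => residue y y)^[k] (residue x x)) : ℝ) * (1 / 2) ^ (k + 1 + 1) =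
      binaryValue (residue x x) * (1 / 2) := by
    rw [binaryValue, ← tsum_mul_right]
    exact tsum_congr fun k => by ring
  rw [h, h1]
  ring

/-- The defect of additivity is bounded, and doubling both arguments modulo `1` doubles it. -/
theorem binaryValue_add (hA : ∀ x y : A, x ≼ y ∨ y ≼ x) (a b : A) :
    binaryValue a + binaryValue b = carry a b + binaryValue (residue a b) := by
  have hstep : ∀ a b : A,
      2 * (binaryValue a + binaryValue b - carry a b - binaryValue (residue a b)) =
        binaryValue (residue a a) + binaryValue (residue b b) -
          carry (residue a a) (residue b b) -
          binaryValue (residue (residue a a) (residue b b)) := by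
    intro a b
    have h1 : carryAdd (carryAdd (0, a) (0, a)) (carryAdd (0, b) (0, b)) =
        carryAdd (carryAdd (0, a) (0, b)) (carryAdd (0, a) (0, b)) := by
      have : Std.Associative (carryAdd : ℕ × A → ℕ × A → ℕ × A) := ⟨carryAdd_assoc hA⟩
      have : Std.Commutative (carryAdd : ℕ × A → ℕ × A → ℕ × A) := ⟨carryAdd_comm⟩
      ac_rfl
    have h2 := congrArg (fun p : ℕ × A => (p.1 : ℝ)) h1
    have h3 := congrArg Prod.snd h1
    simp only [carryAdd, Nat.zero_add, Nat.cast_add] at h2 h3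
    have ha := two_mul_binaryValue a
    have hb := two_mul_binaryValue b
    have hr := two_mul_binaryValue (residue a b)
    rw [h3]
    linarith
  have hbound : ∀ (k : ℕ) (a b : A),
      |binaryValue a + binaryValue b - carry a b - binaryValue (residue a b)| ≤
        2 * (1 / 2) ^ k := by
    intro k
    induction k with
    | zero =>
      intro a b
      have h0 : (carry a b : ℝ) ≤ 1 := by exact_mod_cast carry_le_one a b
      have h1 : (0 : ℝ) ≤ carry a b := Nat.cast_nonneg _
      rw [abs_le]
      constructor <;>
        linarith [binaryValue_nonneg a, binaryValue_nonneg b, binaryValue_nonneg (residue a b),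
          binaryValue_le_one a, binaryValue_le_one b, binaryValue_le_one (residue a b)]
    | succ k ih =>
      intro a b
      have h1 := ih (residue a a) (residue b b)
      rw [← hstep, abs_mul, abs_two] at h1
      rw [pow_succ]
      linarith
  have hlim : Filter.Tendsto (fun k : ℕ => 2 * (1 / 2 : ℝ) ^ k) Filter.atTop (nhds 0) := by
    simpa using (tendsto_pow_atTop_nhds_zero_of_lt_one (r := (1 / 2 : ℝ)) (by norm_num)
      (by norm_num)).const_mul 2
  have h0 := abs_nonpos_iff.1 (ge_of_tendsto' hlim fun k => hbound k a b)
  linarith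

theorem binaryValue_neg_zero : binaryValue (∼0 : A) = 1 := by
  have h := two_mul_binaryValue (∼0 : A)
  rw [carry_of_eq (oplus_neg_zero _), residue_of_eq (oplus_neg_zero _), otimes, neg_neg_eq,
    oplus_zero] at h
  push_cast at h
  linarith

theorem binaryValue_zero (h0 : (∼0 : A) ≠ 0) : binaryValue (0 : A) = 0 := by
  have h1 : (0 : A) ⊕ₘ 0 ≠ ∼0 := by
    rw [oplus_zero]
    exact h0.symm
  have h := two_mul_binaryValue (0 : A)
  rw [carry_of_ne h1, residue_of_ne h1, oplus_zero] at h
  push_cast at h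
  linarith

/-- Every nontrivial MV-chain has a morphism into `[0, 1]`. -/
noncomputable def chainHom (hA : ∀ x y : A, x ≼ y ∨ y ≼ x) (h0 : (∼0 : A) ≠ 0) :
    MVHom A unitInterval where
  toFun x := ⟨binaryValue x, binaryValue_nonneg x, binaryValue_le_one x⟩
  map_zero := Subtype.ext (binaryValue_zero h0)
  map_oplus x y := by
    apply Subtype.ext
    rw [MVX.coe_oplus]
    have h := binaryValue_add hA x y
    dsimp only
    by_cases hxy : x ⊕ₘ y = ∼0
    · rw [carry_of_eq hxy] at h
      push_cast at h
      rw [hxy, binaryValue_neg_zero, min_eq_left]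
      linarith [binaryValue_nonneg (residue x y)]
    · rw [carry_of_ne hxy, residue_of_ne hxy] at h
      push_cast at h
      rw [h, zero_add, min_eq_right (binaryValue_le_one _)]
  map_neg x := by
    apply Subtype.ext
    rw [MVX.coe_neg]
    have h1 : x ⊕ₘ ∼x = ∼0 := by rw [oplus_comm, neg_oplus_self]
    have h := binaryValue_add hA x ∼x
    rw [carry_of_eq h1, residue_of_eq h1, otimes, neg_neg_eq, neg_oplus_self, neg_neg_eq,
      binaryValue_zero h0] at h
    push_cast at h
    dsimp only
    linarith

end MVAlgebra

/-! ### Maximal ideals are the kernels of unique morphisms into the unit interval -/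

namespace MVIdeal

open MVAlgebra

variable {A : Type*} [MVAlgebra A]

local infixl:65 " ⊕ₘ " => oplus
local infixl:65 " ⊖ₘ " => ominus
local infix:50 " ≼ " => Le
local prefix:max "∼" => neg

theorem distance_mem_iff (I : MVIdeal A) {x y : A} :
    distance x y ∈ I.carrier ↔ x ⊖ₘ y ∈ I.carrier ∧ y ⊖ₘ x ∈ I.carrier :=
  I.oplus_mem_iff

theorem oplus_ominus_oplus_le (x y z w : A) :
    (x ⊕ₘ z) ⊖ₘ (y ⊕ₘ w) ≼ (x ⊖ₘ y) ⊕ₘ (z ⊖ₘ w) := by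
  rw [ominus_le_iff]
  have h := oplus_le_oplus (ominus_le_iff.1 (le_refl (x ⊖ₘ y)))
    (ominus_le_iff.1 (le_refl (z ⊖ₘ w)))
  have h1 : (x ⊖ₘ y) ⊕ₘ (z ⊖ₘ w) ⊕ₘ (y ⊕ₘ w) = (x ⊖ₘ y ⊕ₘ y) ⊕ₘ (z ⊖ₘ w ⊕ₘ w) := by ac_rfl
  rwa [h1]

theorem neg_ominus_neg (x y : A) : ∼x ⊖ₘ ∼y = y ⊖ₘ x := by
  rw [ominus_eq, ominus_eq, neg_neg_eq, oplus_comm]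

/-- The quotient MV-algebra `A/I`. -/
instance quotientMVAlgebra (I : MVIdeal A) : MVAlgebra (Quotient I.setoid) where
  zero := Quotient.mk _ 0
  oplus := Quotient.map₂ oplus (by
    intro x y hxy z w hzw
    obtain ⟨h1, h2⟩ := I.distance_mem_iff.1 hxy
    obtain ⟨h3, h4⟩ := I.distance_mem_iff.1 hzw
    exact I.distance_mem_iff.2
      ⟨I.down_closed _ _ (I.oplus_mem _ _ h1 h3) (oplus_ominus_oplus_le x y z w),
        I.down_closed _ _ (I.oplus_mem _ _ h2 h4) (oplus_ominus_oplus_le y x w z)⟩)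
  neg := Quotient.map neg (by
    intro x y hxy
    obtain ⟨h1, h2⟩ := I.distance_mem_iff.1 hxy
    refine I.distance_mem_iff.2 ⟨?_, ?_⟩
    · rwa [neg_ominus_neg]
    · rwa [neg_ominus_neg])
  oplus_assoc := by
    rintro ⟨x⟩ ⟨y⟩ ⟨z⟩
    exact congrArg (Quotient.mk _) (oplus_assoc x y z)
  oplus_comm := by
    rintro ⟨x⟩ ⟨y⟩
    exact congrArg (Quotient.mk _) (oplus_comm x y)
  oplus_zero := by
    rintro ⟨x⟩
    exact congrArg (Quotient.mk _) (oplus_zero x)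
  neg_neg_eq := by
    rintro ⟨x⟩
    exact congrArg (Quotient.mk _) (neg_neg_eq x)
  oplus_neg_zero := by
    rintro ⟨x⟩
    exact congrArg (Quotient.mk _) (oplus_neg_zero x)
  lukasiewicz := by
    rintro ⟨x⟩ ⟨y⟩
    exact congrArg (Quotient.mk _) (lukasiewicz x y)

theorem mk_eq_zero_iff (I : MVIdeal A) {x : A} :
    (Quotient.mk I.setoid x) = 0 ↔ x ∈ I.carrier := by
  have h : (Quotient.mk I.setoid x) = Quotient.mk I.setoid 0 ↔ distance x 0 ∈ I.carrier :=
    Quotient.eq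
  rw [distance_zero] at h
  exact h

theorem IsPrime.quotient_le_total {P : MVIdeal A} (h : P.IsPrime)
    (x y : Quotient P.setoid) : x ≼ y ∨ y ≼ x := by
  induction x using Quotient.inductionOn with | _ x => ?_
  induction y using Quotient.inductionOn with | _ y => ?_
  refine (h.2 x y).imp (fun h => ?_) (fun h => ?_)
  · exact ominus_eq_zero_iff.1 (P.mk_eq_zero_iff.2 h)
  · exact ominus_eq_zero_iff.1 (P.mk_eq_zero_iff.2 h)

/-- Hölder's theorem: the quotient by a maximal ideal embeds into `[0, 1]`. -/
theorem IsMaximal.exists_ker_eq {M : MVIdeal A} (h : M.IsMaximal) :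
    ∃ χ : MVX A, χ.ker = M := by
  let f := chainHom h.isPrime.quotient_le_total
    (fun h0 => h.1 (M.mk_eq_zero_iff.1 h0) : (∼0 : Quotient M.setoid) ≠ 0)
  let χ : MVX A :=
    { toFun := fun x => f.toFun (Quotient.mk _ x)
      map_zero := f.map_zero
      map_oplus := fun x y => f.map_oplus (Quotient.mk _ x) (Quotient.mk _ y)
      map_neg := fun x => f.map_neg (Quotient.mk _ x) }
  refine ⟨χ, h.2 _ (fun x hx => ?_) (MVX.top_notMem_ker χ)⟩
  change f.toFun (Quotient.mk _ x) = 0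
  rw [M.mk_eq_zero_iff.2 hx, f.map_zero]

end MVIdeal

namespace MVX

open MVAlgebra

variable {A : Type*} [MVAlgebra A]

theorem apply_eq_one_iff (χ : MVX A) (x : A) :
    (χ.toFun x : ℝ) = 1 ↔ neg x ∈ χ.ker.carrier := by
  change _ ↔ χ.toFun (neg x) = 0
  rw [χ.map_neg, Subtype.ext_iff, coe_neg]
  change _ ↔ 1 - (χ.toFun x : ℝ) = 0
  constructor <;> intro h <;> linarith

theorem coe_otimes (χ : MVX A) (x y : A) :
    (χ.toFun (otimes x y) : ℝ) = 1 - min 1 (2 - (χ.toFun x : ℝ) - (χ.toFun y : ℝ)) := by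
  rw [otimes, χ.map_neg, χ.map_oplus, χ.map_neg, χ.map_neg, coe_neg, coe_oplus, coe_neg, coe_neg]
  ring_nf

/-- A morphism into `[0, 1]` is determined by its kernel: the kernel decides whether `2 χ(a) ≥ 1`,
so that the distance between two morphisms with the same kernel is doubled at `2a` or `2a - 1`. -/
theorem ker_injective : Function.Injective fun χ : MVX A => χ.ker := by
  intro χ ψ h
  dsimp only at h
  have hbound : ∀ (k : ℕ) (a : A), |(χ.toFun a : ℝ) - ψ.toFun a| ≤ (1 / 2) ^ k := by
    intro k
    induction k with
    | zero =>
      intro a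
      have h1 := (χ.toFun a).2
      have h2 := (ψ.toFun a).2
      rw [pow_zero, abs_le]
      constructor <;> linarith [h1.1, h1.2, h2.1, h2.2]
    | succ k ih =>
      intro a
      rw [pow_succ]
      have hχ : (χ.toFun (oplus a a) : ℝ) = min 1 ((χ.toFun a : ℝ) + χ.toFun a) := by
        rw [χ.map_oplus, coe_oplus]
      have hψ : (ψ.toFun (oplus a a) : ℝ) = min 1 ((ψ.toFun a : ℝ) + ψ.toFun a) := by
        rw [ψ.map_oplus, coe_oplus]
      by_cases h1 : neg (oplus a a) ∈ χ.ker.carrier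
      · have h2 := (apply_eq_one_iff χ _).2 h1
        have h3 := (apply_eq_one_iff ψ _).2 (h ▸ h1)
        rw [hχ, min_eq_left_iff] at h2
        rw [hψ, min_eq_left_iff] at h3
        have h4 := ih (otimes a a)
        rw [coe_otimes, coe_otimes, min_eq_right (by linarith), min_eq_right (by linarith),
          abs_le] at h4
        rw [abs_le]
        constructor <;> linarith [h4.1, h4.2]
      · have h2 := mt (apply_eq_one_iff χ _).1 h1
        have h3 := mt (apply_eq_one_iff ψ _).1 (h ▸ h1)
        rw [hχ, min_eq_left_iff, not_le] at h2
        rw [hψ, min_eq_left_iff, not_le] at h3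
        have h4 := ih (oplus a a)
        rw [hχ, hψ, min_eq_right h2.le, min_eq_right h3.le, abs_le] at h4
        rw [abs_le]
        constructor <;> linarith [h4.1, h4.2]
  apply MVHom.ext
  funext a
  have hlim := tendsto_pow_atTop_nhds_zero_of_lt_one (r := (1 / 2 : ℝ)) (by norm_num)
    (by norm_num)
  have h0 := abs_nonpos_iff.1 (ge_of_tendsto' hlim fun k => hbound k a)
  exact Subtype.ext (by linarith)

end MVX

/-! ### The coZariski spectrum and its étale space -/

namespace MVSpec

open MVAlgebra Topology

variable {A : Type*} [MVAlgebra A]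

theorem isOpen_W (a : A) : IsOpen (W a) :=
  TopologicalSpace.isOpen_generateFrom_of_mem ⟨a, rfl⟩

theorem W_inter_W (a b : A) : W a ∩ W b = W (oplus a b) :=
  Set.ext fun P => P.ideal.oplus_mem_iff.symm

theorem isTopologicalBasis_W :
    TopologicalSpace.IsTopologicalBasis (Set.range (W : A → Set (MVSpec A))) where
  exists_subset_inter := by
    rintro _ ⟨a, rfl⟩ _ ⟨b, rfl⟩ P hP
    exact ⟨_, ⟨oplus a b, rfl⟩, W_inter_W a b ▸ hP, (W_inter_W a b).ge⟩
  sUnion_eq := Set.eq_univ_of_forall fun P => ⟨_, ⟨0, rfl⟩, P.ideal.zero_mem⟩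
  eq_generateFrom := rfl

theorem eq_of_subset {P Q : MVSpec A} (hP : P.ideal.IsMaximal)
    (h : P.ideal.carrier ⊆ Q.ideal.carrier) : P = Q :=
  MVSpec.ext (hP.2 Q.ideal h Q.isPrime.1).symm

/-- If `a ∈ P \ Q` with `Q` maximal, then `P ∈ W_a` and `Q ∈ W_{¬(n a)}` for some `n`, and these
two open sets are disjoint. -/
theorem separate_of_isMaximal {P Q : MVSpec A} (hP : P.ideal.IsMaximal)
    (hQ : Q.ideal.IsMaximal) (hne : P ≠ Q) :
    ∃ a b : A, P ∈ W a ∧ Q ∈ W b ∧ Disjoint (W a) (W b) := by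
  obtain ⟨a, haP, haQ⟩ := Set.not_subset.1 fun h => hne (eq_of_subset hP h)
  obtain ⟨n, hn⟩ := hQ.exists_neg_nmul_mem haQ
  refine ⟨a, _, haP, hn, Set.disjoint_left.2 fun R h1 h2 => R.isPrime.1 ?_⟩
  have h3 := R.ideal.oplus_mem _ _ h2 (R.ideal.nmul_mem h1 n)
  rwa [neg_oplus_self] at h3

theorem t2Space_of_isMaximal (h : ∀ P : MVSpec A, P.ideal.IsMaximal) : T2Space (MVSpec A) where
  t2 P Q hne := by
    obtain ⟨a, b, ha, hb, hab⟩ := separate_of_isMaximal (h P) (h Q) hne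
    exact ⟨_, _, isOpen_W a, isOpen_W b, ha, hb, hab⟩

instance t2Space_maxSpec : T2Space (MVMaxSpec A) where
  t2 P Q hne := by
    obtain ⟨a, b, ha, hb, hab⟩ :=
      separate_of_isMaximal P.2 Q.2 fun h => hne (Subtype.ext h)
    exact ⟨_, _, (isOpen_W a).preimage continuous_subtype_val,
      (isOpen_W b).preimage continuous_subtype_val, ha, hb, hab.preimage _⟩

/-- A proper ideal above a prime `P` is a prime lying in every neighbourhood of `P`. -/
theorem isMaximal_of_specializes_eq (h : ∀ P Q : MVSpec A, Q ⤳ P → Q = P)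
    {P : MVIdeal A} (hP : P.IsPrime) : P.IsMaximal := by
  refine ⟨hP.1, fun J hPJ hJ => ?_⟩
  have h1 : (⟨J, hP.of_subset hPJ hJ⟩ : MVSpec A) ⤳ ⟨P, hP⟩ := by
    rw [specializes_iff_pure, isTopologicalBasis_W.nhds_hasBasis.ge_iff]
    rintro _ ⟨⟨a, rfl⟩, ha⟩
    exact hPJ ha
  exact congrArg MVSpec.ideal (h _ _ h1)

theorem isMaximal_of_isClosed_W (h : ∀ a : A, IsClosed (W a)) {P : MVIdeal A}
    (hP : P.IsPrime) : P.IsMaximal := by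
  refine isMaximal_of_specializes_eq (fun P Q hPQ => MVSpec.ext (MVIdeal.ext ?_)) hP
  refine Set.Subset.antisymm (fun a ha => hPQ.mem_closed (h a) ha)
    (fun a ha => hPQ.mem_open (isOpen_W a) ha)

theorem isClosed_W (hA : IsHyperarchimedean A) (a : A) : IsClosed (W a) := by
  obtain ⟨n, hn, hb⟩ := (hA a).exists_idempotent
  have h : (W a)ᶜ = W (neg (nmul n a)) := by
    ext P
    constructor
    · intro hP
      exact (P.isPrime.mem_or_neg_mem hb).resolve_left fun h1 =>
        hP (P.ideal.down_closed _ _ h1 (le_nmul hn a))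
    · intro hP ha
      have h1 := P.ideal.oplus_mem _ _ hP (P.ideal.nmul_mem ha n)
      rw [neg_oplus_self] at h1
      exact P.isPrime.1 h1
  rw [← isOpen_compl_iff, h]
  exact isOpen_W _

end MVSpec

namespace MVEtale

open MVAlgebra MVSpec Topology

variable {A : Type*} [MVAlgebra A]

theorem hat_eq_hat_iff {a b : A} {P : MVSpec A} :
    hat a P = hat b P ↔ distance a b ∈ P.ideal.carrier := by
  have h : Quotient.mk P.ideal.setoid a = Quotient.mk P.ideal.setoid b ↔ _ := Quotient.eq
  refine Iff.trans ?_ h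
  simp only [hat, MVEtale.mk.injEq, heq_eq_eq, true_and]

theorem exists_hat_eq (e : MVEtale A) : ∃ a : A, hat a e.base = e := by
  obtain ⟨P, x⟩ := e
  obtain ⟨a, rfl⟩ := Quotient.exists_rep x
  exact ⟨a, rfl⟩

theorem isOpen_hat_image_W (a b : A) : IsOpen (hat a '' W b) :=
  TopologicalSpace.isOpen_generateFrom_of_mem ⟨a, b, rfl⟩

theorem hat_injective (a : A) : Function.Injective (hat a) :=
  fun _ _ h => congrArg MVEtale.base h

theorem continuous_hat (a : A) : Continuous (hat a) := by
  refine continuous_generateFrom_iff.2 ?_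
  rintro _ ⟨b, c, rfl⟩
  have h : hat a ⁻¹' (hat b '' W c) = W (distance a b) ∩ W c := by
    ext P
    constructor
    · rintro ⟨Q, hQ, hQP⟩
      obtain rfl : Q = P := congrArg MVEtale.base hQP
      exact ⟨hat_eq_hat_iff.1 hQP.symm, hQ⟩
    · rintro ⟨h1, h2⟩
      exact ⟨P, h2, (hat_eq_hat_iff.2 h1).symm⟩
  rw [h]
  exact (isOpen_W _).inter (isOpen_W _)

theorem isOpenEmbedding_hat (a : A) : IsOpenEmbedding (hat a) := by
  refine .of_continuous_injective_isOpenMap (continuous_hat a) (hat_injective a) ?_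
  refine isTopologicalBasis_W.isOpenMap_iff.2 ?_
  rintro _ ⟨b, rfl⟩
  exact isOpen_hat_image_W a b

/-- The local inverses of the projection are the sections `â`. -/
theorem isLocalHomeomorph_base : IsLocalHomeomorph (MVEtale.base : MVEtale A → MVSpec A) := by
  refine IsLocalHomeomorph.mk _ fun e => ?_
  obtain ⟨a, ha⟩ := exists_hat_eq e
  have : Nonempty (MVSpec A) := ⟨e.base⟩
  refine ⟨((isOpenEmbedding_hat a).toOpenPartialHomeomorph (hat a)).symm, ?_, ?_⟩
  · rw [OpenPartialHomeomorph.symm_source, IsOpenEmbedding.toOpenPartialHomeomorph_target]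
    exact ⟨_, ha⟩
  · intro x hx
    rw [OpenPartialHomeomorph.symm_source, IsOpenEmbedding.toOpenPartialHomeomorph_target] at hx
    obtain ⟨P, rfl⟩ := hx
    exact ((isOpenEmbedding_hat a).toOpenPartialHomeomorph_left_inv (hat a)).symm

theorem t2Space [T2Space (MVSpec A)] (h : ∀ a : A, IsClosed (W a)) : T2Space (MVEtale A) where
  t2 e f hne := by
    by_cases hb : e.base = f.base
    · obtain ⟨a, ha⟩ := exists_hat_eq e
      obtain ⟨b, hb'⟩ := exists_hat_eq f
      rw [← hb] at hb'
      -- the sections through `e` and `f` differ over the complement of `W_{d(a, b)}`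
      have hmem : e.base ∈ (W (distance a b))ᶜ := fun h1 =>
        hne (by rw [← ha, ← hb', hat_eq_hat_iff.2 h1])
      refine ⟨_, _, (isOpenEmbedding_hat a).isOpenMap _ (h (distance a b)).isOpen_compl,
        (isOpenEmbedding_hat b).isOpenMap _ (h (distance a b)).isOpen_compl,
        ⟨_, hmem, ha⟩, ⟨_, hmem, hb'⟩, Set.disjoint_left.2 ?_⟩
      rintro _ ⟨P, hP, rfl⟩ ⟨Q, -, hQ⟩
      obtain rfl : Q = P := congrArg MVEtale.base hQ
      exact hP (hat_eq_hat_iff.1 hQ.symm)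
    · exact separated_by_continuous isLocalHomeomorph_base.continuous hb

/-- `W_a` is the set where the sections `â` and `0̂` agree. -/
theorem isClosed_W_of_t2Space [T2Space (MVEtale A)] (a : A) : IsClosed (W a) := by
  have h : W a = {P | hat a P = hat 0 P} := by
    ext P
    change a ∈ P.ideal.carrier ↔ hat a P = hat 0 P
    rw [hat_eq_hat_iff, distance_zero]
  rw [h]
  exact isClosed_eq (continuous_hat a) (continuous_hat 0)

end MVEtale

/-! ### The space of morphisms into the unit interval -/

namespace MVX

open MVAlgebra Topology

variable {A : Type*} [MVAlgebra A]

theorem continuous_apply (a : A) : Continuous fun χ : MVX A => χ.toFun a :=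
  (_root_.continuous_apply a).comp continuous_induced_dom

theorem continuous_oplus :
    Continuous fun p : unitInterval × unitInterval => oplus p.1 p.2 :=
  Continuous.subtype_mk (f := fun p : unitInterval × unitInterval => min 1 ((p.1 : ℝ) + p.2))
    (by fun_prop) _

theorem continuous_neg : Continuous fun x : unitInterval => neg x :=
  Continuous.subtype_mk (f := fun x : unitInterval => 1 - (x : ℝ)) (by fun_prop) _

theorem isClosedEmbedding_toFun :
    IsClosedEmbedding fun χ : MVX A => χ.toFun where
  eq_induced := rfl
  injective _ _ h := MVHom.ext h
  isClosed_range := by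
    have h : Set.range (fun χ : MVX A => χ.toFun) =
        {f | f 0 = 0} ∩ (⋂ x, ⋂ y, {f | f (oplus x y) = oplus (f x) (f y)}) ∩
          ⋂ x, {f | f (neg x) = neg (f x)} := by
      ext f
      simp only [Set.mem_range, Set.mem_inter_iff, Set.mem_iInter, Set.mem_ofPred_eq]
      constructor
      · rintro ⟨χ, rfl⟩
        exact ⟨⟨χ.map_zero, χ.map_oplus⟩, χ.map_neg⟩
      · rintro ⟨⟨h1, h2⟩, h3⟩
        exact ⟨⟨f, h1, h2, h3⟩, rfl⟩
    rw [h]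
    refine ((isClosed_eq (_root_.continuous_apply 0) continuous_const).inter ?_).inter ?_
    · exact isClosed_iInter fun x => isClosed_iInter fun y =>
        isClosed_eq (_root_.continuous_apply _) (continuous_oplus.comp₂
          (_root_.continuous_apply x) (_root_.continuous_apply y))
    · exact isClosed_iInter fun x => isClosed_eq (_root_.continuous_apply _)
        (continuous_neg.comp (_root_.continuous_apply x))

instance compactSpace : CompactSpace (MVX A) := isClosedEmbedding_toFun.compactSpace

theorem isClosed_W (a : A) : IsClosed (W a) :=
  isClosed_singleton.preimage (continuous_apply a)

/-- If `b = n a` is idempotent then `χ(b) ∈ {0, 1}`, so that `χ(a) = 0` as soon as `χ(b) < 1`. -/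
theorem isOpen_W (hA : IsHyperarchimedean A) (a : A) : IsOpen (W a) := by
  obtain ⟨n, hn, hb⟩ := (hA a).exists_idempotent
  have h : W a = {χ : MVX A | (χ.toFun (nmul n a) : ℝ) < 1} := by
    ext χ
    constructor
    · intro h
      have h1 : χ.toFun (nmul n a) = 0 := χ.ker.nmul_mem h n
      change (χ.toFun (nmul n a) : ℝ) < 1
      rw [h1]
      exact zero_lt_one
    · intro h
      rcases χ.ker_isPrime.mem_or_neg_mem hb with h1 | h1
      · exact χ.ker.down_closed _ _ h1 (le_nmul hn a)
      · exact absurd ((apply_eq_one_iff χ _).2 h1) (ne_of_lt h)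
  rw [h]
  exact isOpen_lt (continuous_subtype_val.comp (continuous_apply _)) continuous_const

theorem continuous_kappa_iff : Continuous (kappa A) ↔ ∀ a : A, IsOpen (W a) := by
  refine continuous_generateFrom_iff.trans ?_
  rw [Set.forall_mem_range]
  exact Iff.rfl

theorem kappa_injective : Function.Injective (kappa A) :=
  fun _ _ h => ker_injective (congrArg MVSpec.ideal h)

theorem kappaMax_bijective : Function.Bijective (kappaMax A) := by
  refine ⟨fun _ _ h => kappa_injective (congrArg Subtype.val h), fun P => ?_⟩
  obtain ⟨χ, hχ⟩ := P.2.exists_ker_eq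
  exact ⟨χ, Subtype.ext (MVSpec.ext hχ)⟩

theorem continuous_kappaMax_iff : Continuous (kappaMax A) ↔ Continuous (kappa A) :=
  continuous_induced_rng

theorem isHomeomorph_kappaMax (h : Continuous (kappa A)) : IsHomeomorph (kappaMax A) :=
  isHomeomorph_iff_continuous_bijective.2 ⟨continuous_kappaMax_iff.2 h, kappaMax_bijective⟩

theorem isHomeomorph_kappa (hA : IsHyperarchimedean A) : IsHomeomorph (kappa A) := by
  have hmax : ∀ P : MVSpec A, P.ideal.IsMaximal := fun P => P.isPrime.isMaximal hA
  have := MVSpec.t2Space_of_isMaximal hmax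
  refine isHomeomorph_iff_continuous_bijective.2
    ⟨continuous_kappa_iff.2 (isOpen_W hA), kappa_injective, fun P => ?_⟩
  obtain ⟨χ, hχ⟩ := (hmax P).exists_ker_eq
  exact ⟨χ, MVSpec.ext hχ⟩

end MVX

/-! ### Hyperarchimedean algebras -/

namespace MVAlgebra

variable {A : Type*} [MVAlgebra A]

theorem isStoneSpace_spec (hA : IsHyperarchimedean A) : IsStoneSpace (MVSpec A) := by
  refine ⟨?_, MVSpec.t2Space_of_isMaximal fun P => P.isPrime.isMaximal hA, ?_⟩
  · exact ((MVX.isHomeomorph_kappa hA).homeomorph _).compactSpace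
  · refine MVSpec.isTopologicalBasis_W.of_isOpen_of_subset (fun s hs => hs.isOpen) ?_
    rintro _ ⟨a, rfl⟩
    exact ⟨MVSpec.isClosed_W hA a, MVSpec.isOpen_W a⟩

/-- For each `a`, the open sets `W_a` and `W_{¬(n a)}` cover the maximal spectrum; a finite subcover
provides an `n` for which `a ∧ ¬(n a)` lies in every maximal ideal, hence is zero. -/
theorem isHyperarchimedean_of_compactSpace_maxSpec (hs : IsSemisimple A)
    [CompactSpace (MVMaxSpec A)] : IsHyperarchimedean A := by
  intro a
  let U : ℕ → Set (MVMaxSpec A) := fun n =>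
    Subtype.val ⁻¹' (MVSpec.W a ∪ MVSpec.W (neg (nmul n a)))
  have hmono : Monotone U := fun n m hnm P => Or.imp_right fun h =>
    P.1.ideal.down_closed _ _ h (neg_le_neg (nmul_le_nmul hnm a))
  have hcover : Set.univ ⊆ ⋃ n, U n := by
    intro P _
    by_cases ha : a ∈ P.1.ideal.carrier
    · exact Set.mem_iUnion.2 ⟨0, Or.inl ha⟩
    · obtain ⟨n, hn⟩ := P.2.exists_neg_nmul_mem ha
      exact Set.mem_iUnion.2 ⟨n, Or.inr hn⟩
  obtain ⟨n, hn⟩ := isCompact_univ.elim_directed_cover U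
    (fun n => ((MVSpec.isOpen_W _).union (MVSpec.isOpen_W _)).preimage continuous_subtype_val)
    hcover hmono.directed_le
  refine IsArchimedean.of_isDisjoint (n := n) fun t h1 h2 => hs.2 t fun M hM => ?_
  rcases hn (Set.mem_univ (⟨⟨M, hM.isPrime⟩, hM⟩ : MVMaxSpec A)) with h | h
  · exact M.down_closed _ _ h h1
  · exact M.down_closed _ _ h h2

end MVAlgebra

theorem theorem5 (A : Type*) [MVAlgebra A] :
    (List.TFAE [
        MVAlgebra.IsHyperarchimedean A,
        ∀ P : MVIdeal A, P.IsPrime → P.IsMaximal,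
        T2Space (MVSpec A),
        IsHausdorffSheaf (MVEtale.base : MVEtale A → MVSpec A),
        ∀ a : A, IsClosed (MVSpec.W a),
        IsHomeomorph (MVX.kappa A),
        IsStoneSpace (MVSpec A)] ∧
      (∀ a : A, IsClosed (MVSpec.W a) → IsClopen (MVSpec.W a)) ∧
      (IsHomeomorph (MVX.kappa A) → IsHomeomorph (MVX.kappaMax A))) ∧
    (MVAlgebra.IsSemisimple A →
      List.TFAE [
        MVAlgebra.IsHyperarchimedean A,
        ∀ a : A, IsOpen (MVX.W a),
        Continuous (MVX.kappa A),
        CompactSpace (MVMaxSpec A),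
        IsHomeomorph (MVX.kappaMax A)] ∧
      (∀ a : A, IsOpen (MVX.W a) → IsClopen (MVX.W a))) := by
  refine ⟨⟨?_, fun a h => ⟨h, MVSpec.isOpen_W a⟩,
    fun h => MVX.isHomeomorph_kappaMax h.continuous⟩,
    fun hs => ⟨?_, fun a h => ⟨MVX.isClosed_W a, h⟩⟩⟩
  · tfae_have 1 → 2 := fun hA P hP => hP.isMaximal hA
    tfae_have 2 → 1 := MVIdeal.isHyperarchimedean_of_isPrime_isMaximal
    tfae_have 2 → 3 := fun h => MVSpec.t2Space_of_isMaximal fun P => h _ P.isPrime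
    tfae_have 3 → 2 := fun _ P hP =>
      MVSpec.isMaximal_of_specializes_eq (fun _ _ h => h.eq) hP
    tfae_have 1 → 5 := MVSpec.isClosed_W
    tfae_have 5 → 2 := fun h P hP => MVSpec.isMaximal_of_isClosed_W h hP
    tfae_have 5 → 4 := fun h => by
      have := MVSpec.t2Space_of_isMaximal fun P =>
        MVSpec.isMaximal_of_isClosed_W h P.isPrime
      exact ⟨MVEtale.isLocalHomeomorph_base, MVEtale.t2Space h⟩
    tfae_have 4 → 5 := fun ⟨_, _⟩ a => MVEtale.isClosed_W_of_t2Space a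
    tfae_have 1 → 6 := MVX.isHomeomorph_kappa
    tfae_have 6 → 2 := fun h P hP => by
      obtain ⟨χ, hχ⟩ := h.surjective ⟨P, hP⟩
      have h1 : χ.ker = P := congrArg MVSpec.ideal hχ
      exact h1 ▸ χ.ker_isMaximal
    tfae_have 1 → 7 := MVAlgebra.isStoneSpace_spec
    tfae_have 7 → 3 := fun h => h.2.1
    tfae_finish
  · tfae_have 1 → 2 := MVX.isOpen_W
    tfae_have 2 ↔ 3 := MVX.continuous_kappa_iff.symm
    tfae_have 3 → 5 := MVX.isHomeomorph_kappaMax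
    tfae_have 5 → 4 := fun h => (h.homeomorph _).compactSpace
    tfae_have 4 → 1 := fun _ => MVAlgebra.isHyperarchimedean_of_compactSpace_maxSpec hs
    tfae_finish
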